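/- Consider the Calogero--Bogoyavlenskii--Schiff equation $$\mathcal E:\qquad u_{tx}=2u_yu_{xx}+4u_xu_{xy}-u_{xxxy}$$ with its infinite prolongation, on which $t,x,y$, $u_{x^iy^j}$ and $u_{t^{i+1}y^j}$ ($i,j\ge 0$) serve as internal coordinates, and let $D_t,D_x,D_y$ be the total derivatives on $\mathcal E$. A \emph{local} function is a $C^\infty$ function of finitely many of these coordinates. A \emph{local symmetry} is a local function $\varphi$ with $$D_tD_x\varphi-2u_{xx}D_y\varphi-2u_yD_x^2\varphi-4u_{xy}D_x\varphi-4u_xD_xD_y\varphi+D_x^3D_y\varphi=0 .$$ The recursion operator $\Psi=\mathcal R_0(\Phi)$ is the relation $$D_x\Psi=4u_xD_x\Phi+2u_{xx}\Phi-D_x^3\Phi,\qquad D_y\Psi=D_t\Phi-2u_yD_x\Phi+2u_{xy}\Phi,$$ which determines $\Psi$ only up to functions annihilated by $D_x$ and $D_y$; on $\mathcal E$ these are the functions of $t$. A covering of $\mathcal E$ adds a (possibly infinite) family of nonlocal variables $w^\alpha$ with commuting total derivatives $\tilde D_i=D_i+\sum_\alpha X_i^\alpha\,\partial/\partial w^\alpha$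 ($i=t,x,y$), where the $X_i^\alpha$ are smooth functions of finitely many of the coordinates and nonlocal variables; there $\mathcal R_0$ is given by the same relation with $D_i$ replaced by $\tilde D_i$. \textbf{Proposition.} All the symmetries $\chi_1=u_x$, $\mathcal R_0(\chi_{2k+1})=-\chi_{2k+3}$ ($k=0,1,\dots$), generated by iterating $\mathcal R_0$ on $u_x$ are local. That is: 1. There is exactly one sequence of local functions $\chi_1,\chi_3,\chi_5,\dots$ with $\chi_1=u_x$ and $\mathcal R_0(\chi_{2k+1})=-\chi_{2k+3}$ for all $k\ge 0$ such that every $\chi_{2k+1}$ vanishes on the zero solution (i.e. wherever all the coordinates $u_{x^iy^j}$, $u_{t^{i+1}y^j}$ vanish), and all its members are local symmetries. 2. The same holds for any other choice of the functions of $t$ arising at each step: if $\chi_1=u_x,\chi_3,\dots,\chi_{2n+1}$ are local functions with $\mathcal R_0(\chi_{2k+1})=-\chi_{2k+3}$ for $0\le k<n$, then there is a local symmetry $\chi_{2n+3}$ with $\mathcal R_0(\chi_{2n+1})=-\chi_{2n+3}$. 3. Iterating in a covering produces no dependence on nonlocal variables: in any covering in which only the smooth functions of $t$ are annihilated by both $\tilde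 D_x$ and $\tilde D_y$, let $\chi_1=u_x,\chi_3,\dots,\chi_{2n+1}$ be smooth functions of finitely many of the coordinates and nonlocal variables with $\mathcal R_0(\chi_{2k+1})=-\chi_{2k+3}$ for $0\le k<n$. Then each $\chi_{2k+1}$, $0\le k\le n$, is a local symmetry; in particular it does not depend on the $w^\alpha$. -/

import Mathlib

open scoped ContDiff

noncomputable section

namespace CBS

/-! ### Smooth functions and vector fields on spaces with possibly infinitely many coordinates -/

/-- The real-valued functions on the space with coordinates labelled by `J`. -/
abbrev Fn (J : Type*) : Type _ := (J → ℝ) → ℝ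

/-- A smooth function on `J → ℝ`: it depends on finitely many coordinates only, and it is a
`C^∞` function of them. -/
def IsSmooth {J : Type*} (f : Fn J) : Prop :=
  ∃ (s : Finset J) (g : (s → ℝ) → ℝ), ContDiff ℝ ∞ g ∧ ∀ p : J → ℝ, f p = g (fun j => p j)

open Classical in
/-- The partial derivative `∂f/∂v` in the coordinate labelled by `v`. -/
def pd {J : Type*} (v : J) (f : Fn J) : Fn J :=
  fun p => lineDeriv ℝ f p (Pi.single v 1)

/-- The vector field `∑_v a_v ∂/∂v` acting on functions. (On a smooth function the sum is finite,
because only finitely many partial derivatives are not identically zero.) -/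
def vectorField {J : Type*} (a : J → Fn J) (f : Fn J) : Fn J :=
  fun p => ∑ᶠ v, a v p * pd v f p

/-! ### The infinitely prolonged equation `u_tx = 2 u_y u_xx + 4 u_x u_xy - u_xxxy` -/

/-- Internal coordinates on the infinitely prolonged equation: the independent variables
`t, x, y` and the derivatives of `u` that are not derivatives of `u_tx`, namely
`ux i j = ∂_x^i ∂_y^j u` and `ut i j = ∂_t^(i+1) ∂_y^j u`. -/
inductive Coord : Type
  | t : Coord
  | x : Coord
  | y : Coord
  | ux (i j : ℕ) : Coord
  | ut (i j : ℕ) : Coord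

/-- The jet variable `∂_x^i ∂_y^j u` as a function on the equation. -/
def U (i j : ℕ) : Fn Coord := fun p => p (.ux i j)

/-- The right-hand side `2 u_y u_xx + 4 u_x u_xy - u_xxxy`. -/
def rhs : Fn Coord := 2 * U 0 1 * U 2 0 + 4 * U 1 0 * U 1 1 - U 3 1

/-- Components of the total derivative in `y`. -/
def yCoeff : Coord → Fn Coord
  | .t => 0
  | .x => 0
  | .y => 1
  | .ux i j => fun p => p (.ux i (j + 1))
  | .ut i j => fun p => p (.ut i (j + 1))

/-- The total derivative `D_y` on the equation. -/
def Dy : Fn Coord → Fn Coord := vectorField yCoeff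

/-- The total derivative in `x` on functions which do not involve the coordinates `ut i j`;
it is used only to express `D_x^i D_y^j` of `rhs`. -/
def Dx₀ : Fn Coord → Fn Coord := vectorField fun
  | .t => 0
  | .x => 1
  | .y => 0
  | .ux i j => fun p => p (.ux (i + 1) j)
  | .ut _ _ => 0

/-- Components of the total derivative in `t`: the derivative
`∂_t ∂_x^(i+1) ∂_y^j u` is replaced by `D_x^i D_y^j` of `rhs`. -/
def tCoeff : Coord → Fn Coord
  | .t => 1
  | .x => 0
  | .y => 0
  | .ux 0 j => fun p => p (.ut 0 j)
  | .ux (i + 1) j => Dx₀^[i] (Dy^[j] rhs)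
  | .ut i j => fun p => p (.ut (i + 1) j)

/-- The total derivative `D_t` on the equation. -/
def Dt : Fn Coord → Fn Coord := vectorField tCoeff

/-- Components of the total derivative in `x`: the derivative
`∂_x ∂_t^(i+1) ∂_y^j u` is replaced by `D_t^i D_y^j` of `rhs`. -/
def xCoeff : Coord → Fn Coord
  | .t => 0
  | .x => 1
  | .y => 0
  | .ux i j => fun p => p (.ux (i + 1) j)
  | .ut i j => Dt^[i] (Dy^[j] rhs)

/-- The total derivative `D_x` on the equation. -/
def Dx : Fn Coord → Fn Coord := vectorField xCoeff

/-- The linearization `ℓ` of the equation, restricted to the equation. -/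
def linearization (φ : Fn Coord) : Fn Coord :=
  Dt (Dx φ) - 2 * U 2 0 * Dy φ - 2 * U 0 1 * Dx (Dx φ)
    - 4 * U 1 1 * Dx φ - 4 * U 1 0 * Dx (Dy φ) + Dx (Dx (Dx (Dy φ)))

/-- A local symmetry (identified with its generating function): a smooth function of finitely many
of the variables `t`, `x`, `y` and jet variables, annihilated by the linearization. -/
def IsLocalSymmetry (φ : Fn Coord) : Prop := IsSmooth φ ∧ linearization φ = 0

/-- The relation `Ψ = R₀(Φ)` for functions on the equation:
`Ψ_x = 4 u_x Φ_x + 2 u_xx Φ - Φ_xxx` and `Ψ_y = Φ_t - 2 u_y Φ_x + 2 u_xy Φ`. -/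
def R₀ (Φ Ψ : Fn Coord) : Prop :=
  Dx Ψ = 4 * U 1 0 * Dx Φ + 2 * U 2 0 * Φ - Dx (Dx (Dx Φ)) ∧
  Dy Ψ = Dt Φ - 2 * U 0 1 * Dx Φ + 2 * U 1 1 * Φ

/-- `f` vanishes on the zero solution `u = 0`. -/
def VanishesAtZero (f : Fn Coord) : Prop :=
  ∀ p : Coord → ℝ, (∀ i j, p (.ux i j) = 0) → (∀ i j, p (.ut i j) = 0) → f p = 0

/-! ### Coverings and nonlocal variables -/

/-- The pull-back to a covering of a function on the equation. -/
def pullback {ι : Type*} (f : Fn Coord) : Fn (Coord ⊕ ι) := fun p => f fun c => p (Sum.inl c)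

/-- The field with components `a` along the equation and `X` along the nonlocal variables. -/
def liftField {ι : Type*} (a : Coord → Fn Coord) (X : ι → Fn (Coord ⊕ ι)) :
    Fn (Coord ⊕ ι) → Fn (Coord ⊕ ι) :=
  vectorField (Sum.elim (fun c => pullback (a c)) X)

/-- A (differential) covering of the equation with nonlocal variables `w^α`, `α : ι`:
the lifted total derivatives `D_i + ∑_α X_i^α ∂/∂w^α` commute; equivalently, the system
`∂w^α/∂x^i = X_i^α` is compatible on the equation. -/
structure Covering (ι : Type*) where
  Xt : ι → Fn (Coord ⊕ ι)
  Xx : ι → Fn (Coord ⊕ ι)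
  Xy : ι → Fn (Coord ⊕ ι)
  smooth_t : ∀ α, IsSmooth (Xt α)
  smooth_x : ∀ α, IsSmooth (Xx α)
  smooth_y : ∀ α, IsSmooth (Xy α)
  comm_tx : ∀ α, liftField tCoeff Xt (Xx α) = liftField xCoeff Xx (Xt α)
  comm_ty : ∀ α, liftField tCoeff Xt (Xy α) = liftField yCoeff Xy (Xt α)
  comm_xy : ∀ α, liftField xCoeff Xx (Xy α) = liftField yCoeff Xy (Xx α)

namespace Covering

variable {ι : Type*} (τ : Covering ι)

/-- The total derivative in `t` on the covering. -/
def Dt : Fn (Coord ⊕ ι) → Fn (Coord ⊕ ι) := liftField tCoeff τ.Xt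

/-- The total derivative in `x` on the covering. -/
def Dx : Fn (Coord ⊕ ι) → Fn (Coord ⊕ ι) := liftField xCoeff τ.Xx

/-- The total derivative in `y` on the covering. -/
def Dy : Fn (Coord ⊕ ι) → Fn (Coord ⊕ ι) := liftField yCoeff τ.Xy

/-- The relation `Ψ = R₀(Φ)` for functions on the covering, which may involve nonlocal
variables. -/
def R₀ (Φ Ψ : Fn (Coord ⊕ ι)) : Prop :=
  τ.Dx Ψ = 4 * pullback (U 1 0) * τ.Dx Φ + 2 * pullback (U 2 0) * Φ
    - τ.Dx (τ.Dx (τ.Dx Φ)) ∧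
  τ.Dy Ψ = τ.Dt Φ - 2 * pullback (U 0 1) * τ.Dx Φ + 2 * pullback (U 1 1) * Φ

/-- The only functions annihilated by both `D_x` and `D_y` are the functions of `t`. -/
def OnlyTrivialConstants : Prop :=
  ∀ f : Fn (Coord ⊕ ι), IsSmooth f → τ.Dx f = 0 → τ.Dy f = 0 →
    ∃ A : ℝ → ℝ, ContDiff ℝ ∞ A ∧ ∀ p, f p = A (p (Sum.inl .t))

end Covering

end CBS

end

/-! The `x`-part of the recursion operator is the Lenard recursion of the KdV hierarchy with
potential `w = u_x`. Put the iterates into a power series `B` with leading coefficient `1`. The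
recursion then reads `B_x = X (4 w B_x + 2 w_x B - B_xxx)`, and it has the first integral `B² = 1 +
X (4 w B² - 2 B B_xx + B_x²)`. This quadratic identity determines the coefficients of `B`
algebraically, with no integration, so they are differential polynomials in `u_x`; this is where
locality comes from (`resolvent_quadratic`, `resolvent_lenard`). The coefficient after the leading
`1` is `2 u_x`.

The `y`-part of the recursion is a second linear relation for `B`. By the equation, the defect `F`
of that relation satisfies a homogeneous linear equation of the form `B F = X (...)`. Since `B` is a
unit, `F` is divisible by every power of `X`, hence zero (`resolvent_flow`).

Each step leaves a function `A(t)` free (`exists_eq_comp_t`). Such a function also starts an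
infinite local chain: multiply `B` by `K = ∑ (yⁿ/n!) A⁽ⁿ⁾(t) Xⁿ`, which satisfies `K_x = 0` and `K_y
= X K_t`, so `K B` obeys the same two relations (`series_mul_resolvent`, `iterable_timeFn`).
Functions that start an infinite local chain form a linear space, so every choice of constants stays
inside it (`Iterable.next`). The existence of one further step makes a function a symmetry, by
cross-differentiation (`symmetry_of_recursion`). In a covering with trivial constants, any result
differs from a pulled-back local one by a function of `t`, so nonlocal variables never enter. -/

noncomputable section

namespace CBS

/-- `f` is a smooth function of the coordinates in the finite set `s`. -/
def SmoothIn {J : Type*} (s : Finset J) (f : Fn J) : Prop :=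
  ∃ g : (s → ℝ) → ℝ, ContDiff ℝ ∞ g ∧ ∀ p : J → ℝ, f p = g (fun j => p j)

/-! ### Calculus of smooth functions and vector fields in infinitely many coordinates. -/

section Smooth

variable {J : Type*} {s s' : Finset J} {f g : Fn J}

theorem SmoothIn.isSmooth (h : SmoothIn s f) : IsSmooth f :=
  let ⟨g, hg⟩ := h
  ⟨s, g, hg⟩

theorem SmoothIn.mono (h : SmoothIn s f) (hs : s ⊆ s') : SmoothIn s' f := by
  obtain ⟨g, hg, hf⟩ := h
  refine ⟨fun q => g fun j => q ⟨j, hs j.2⟩, hg.comp ?_, fun p => hf p⟩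
  exact contDiff_pi.2 fun j => contDiff_apply ℝ ℝ _

theorem SmoothIn.add (hf : SmoothIn s f) (hg : SmoothIn s g) : SmoothIn s (f + g) := by
  obtain ⟨f', hf', hf⟩ := hf
  obtain ⟨g', hg', hg⟩ := hg
  exact ⟨f' + g', hf'.add hg', fun p => by simp [hf p, hg p]⟩

theorem SmoothIn.mul (hf : SmoothIn s f) (hg : SmoothIn s g) : SmoothIn s (f * g) := by
  obtain ⟨f', hf', hf⟩ := hf
  obtain ⟨g', hg', hg⟩ := hg
  exact ⟨f' * g', hf'.mul hg', fun p => by simp [hf p, hg p]⟩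

theorem IsSmooth.exists_smoothIn (hf : IsSmooth f) (hg : IsSmooth g) :
    ∃ s, SmoothIn s f ∧ SmoothIn s g := by
  classical
  obtain ⟨s, hs⟩ := hf
  obtain ⟨s', hs'⟩ := hg
  exact ⟨s ∪ s', SmoothIn.mono hs Finset.subset_union_left,
    SmoothIn.mono hs' Finset.subset_union_right⟩

theorem IsSmooth.add (hf : IsSmooth f) (hg : IsSmooth g) : IsSmooth (f + g) :=
  let ⟨_, hf, hg⟩ := hf.exists_smoothIn hg
  (hf.add hg).isSmooth

theorem IsSmooth.mul (hf : IsSmooth f) (hg : IsSmooth g) : IsSmooth (f * g) :=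
  let ⟨_, hf, hg⟩ := hf.exists_smoothIn hg
  (hf.mul hg).isSmooth

theorem isSmooth_const (r : ℝ) : IsSmooth (fun _ : J → ℝ => r) :=
  ⟨∅, fun _ => r, contDiff_const, fun _ => rfl⟩

theorem isSmooth_comp_coord {A : ℝ → ℝ} (hA : ContDiff ℝ ∞ A) (v : J) :
    IsSmooth (fun p : J → ℝ => A (p v)) :=
  ⟨{v}, fun q => A (q ⟨v, by simp⟩), hA.comp (contDiff_apply ℝ ℝ _), fun _ => rfl⟩

theorem isSmooth_coord (v : J) : IsSmooth (fun p : J → ℝ => p v) :=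
  isSmooth_comp_coord contDiff_id v

-- For infinite `J` the space `J → ℝ` carries no norm, so differentiation is transferred to the
-- finite-dimensional factor `g`.
open Classical in
theorem hasLineDerivAt_of_comp {g : (s → ℝ) → ℝ} (hg : ContDiff ℝ ∞ g)
    (hf : ∀ p : J → ℝ, f p = g (fun j => p j)) (p q : J → ℝ) :
    HasLineDerivAt ℝ f (fderiv ℝ g (fun j => p j) (fun j => q j)) p q := by
  have h := ((hg.differentiable (by simp)) (fun j => p j)).hasFDerivAt.hasLineDerivAt
    (fun j : s => q j)
  unfold HasLineDerivAt at h ⊢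
  convert h using 2 with t
  exact hf _

open Classical in
theorem IsSmooth.hasLineDerivAt_pd (hf : IsSmooth f) (v : J) (p : J → ℝ) :
    HasLineDerivAt ℝ f (pd v f p) p (Pi.single v 1) := by
  obtain ⟨s, g, hg, hf⟩ := hf
  exact (hasLineDerivAt_of_comp hg hf p _).lineDifferentiableAt.hasLineDerivAt

open Classical in
theorem pd_eq_of_comp {g : (s → ℝ) → ℝ} (hg : ContDiff ℝ ∞ g)
    (hf : ∀ p : J → ℝ, f p = g (fun j => p j)) (v : J) (p : J → ℝ) :
    pd v f p = fderiv ℝ g (fun j => p j) (fun j => (Pi.single v 1 : J → ℝ) j) :=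
  (hasLineDerivAt_of_comp hg hf p _).lineDeriv

theorem SmoothIn.pd (hf : SmoothIn s f) (v : J) : SmoothIn s (pd v f) := by
  classical
  obtain ⟨g, hg, hf⟩ := hf
  exact ⟨fun q => fderiv ℝ g q (fun j => (Pi.single v 1 : J → ℝ) j),
    (hg.fderiv_right (by simp)).clm_apply contDiff_const, fun p => pd_eq_of_comp hg hf v p⟩

theorem IsSmooth.pd (hf : IsSmooth f) (v : J) : IsSmooth (pd v f) :=
  let ⟨_, h⟩ := hf
  (SmoothIn.pd h v).isSmooth

theorem SmoothIn.pd_eq_zero (hf : SmoothIn s f) {v : J} (hv : v ∉ s) : CBS.pd v f = 0 := by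
  classical
  obtain ⟨g, hg, hf⟩ := hf
  funext p
  rw [pd_eq_of_comp hg hf]
  have : (fun j : s => (Pi.single v 1 : J → ℝ) j) = 0 := by
    funext j
    refine Pi.single_eq_of_ne ?_ _
    rintro rfl
    exact hv j.2
  simp [this]

theorem pd_comm (hf : IsSmooth f) (v w : J) : pd v (pd w f) = pd w (pd v f) := by
  classical
  obtain ⟨s, g, hg, hf⟩ := hf
  have key (v w : J) (p : J → ℝ) : pd v (pd w f) p =
      fderiv ℝ (fderiv ℝ g) (fun j => p j) (fun j => (Pi.single v 1 : J → ℝ) j)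
        (fun j => (Pi.single w 1 : J → ℝ) j) := by
    have hd : ContDiff ℝ ∞ (fderiv ℝ g) := hg.fderiv_right (by simp)
    rw [pd_eq_of_comp (g := fun q => fderiv ℝ g q (fun j => (Pi.single w 1 : J → ℝ) j))
      (hd.clm_apply contDiff_const) (fun p => pd_eq_of_comp hg hf w p),
      fderiv_clm_apply (hd.differentiable (by simp) _) (by fun_prop)]
    simp
  funext p
  rw [key, key]
  exact (hg.contDiffAt.isSymmSndFDerivAt
    (by rw [minSmoothness_of_isRCLikeNormedField]; exact WithTop.coe_le_coe.2 le_top)).eq _ _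

theorem pd_add (hf : IsSmooth f) (hg : IsSmooth g) (v : J) : pd v (f + g) = pd v f + pd v g := by
  classical
  funext p
  exact (HasDerivAt.add (hf.hasLineDerivAt_pd v p) (hg.hasLineDerivAt_pd v p)).deriv

theorem pd_mul (hf : IsSmooth f) (hg : IsSmooth g) (v : J) :
    pd v (f * g) = f * pd v g + g * pd v f := by
  classical
  funext p
  have h := (HasDerivAt.mul (hf.hasLineDerivAt_pd v p) (hg.hasLineDerivAt_pd v p)).deriv
  simp only [zero_smul, add_zero] at h
  refine Eq.trans h ?_
  simp only [Pi.add_apply, Pi.mul_apply]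
  ring

theorem pd_const (r : ℝ) (v : J) : pd v (fun _ : J → ℝ => r) = 0 := by
  funext p
  simp [pd, lineDeriv]

open Classical in
theorem pd_comp_coord (A : ℝ → ℝ) (v w : J) :
    pd v (fun p : J → ℝ => A (p w)) = fun p => if w = v then deriv A (p w) else 0 := by
  funext p
  unfold pd lineDeriv
  by_cases h : w = v
  · subst h
    simp only [Pi.add_apply, Pi.smul_apply, Pi.single_eq_same, smul_eq_mul, mul_one, if_true]
    simpa using deriv_comp_const_add A (p w) 0
  · simp [h]

theorem vectorField_eq_sum (a : J → Fn J) (hf : SmoothIn s f) :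
    vectorField a f = ∑ v ∈ s, a v * pd v f := by
  funext p
  rw [vectorField, finsum_eq_sum_of_support_subset (s := s)]
  · simp
  · intro v hv
    by_contra h
    exact hv (by simp [hf.pd_eq_zero h])

variable (J) in
/-- The algebra of smooth functions. -/
def smoothFn : Subalgebra ℝ (Fn J) where
  carrier := {f | IsSmooth f}
  mul_mem' := IsSmooth.mul
  add_mem' := IsSmooth.add
  algebraMap_mem' := isSmooth_const

theorem IsSmooth.vectorField {a : J → Fn J} (ha : ∀ v, IsSmooth (a v)) (hf : IsSmooth f) :
    IsSmooth (vectorField a f) := by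
  obtain ⟨s, hs⟩ := hf
  rw [vectorField_eq_sum a (s := s) hs]
  exact (smoothFn J).sum_mem fun v _ => (ha v).mul (IsSmooth.pd ⟨s, hs⟩ v)

/-- The derivation of the algebra of smooth functions defined by a smooth vector field. -/
def fieldDerivation (a : J → Fn J) (ha : ∀ v, IsSmooth (a v)) :
    Derivation ℝ (smoothFn J) (smoothFn J) :=
  Derivation.mk'
    { toFun := fun f => ⟨vectorField a f, IsSmooth.vectorField ha f.2⟩
      map_add' := fun f g => by
        obtain ⟨s, hf, hg⟩ := IsSmooth.exists_smoothIn f.2 g.2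
        apply Subtype.ext
        simp only [Subalgebra.coe_add]
        rw [vectorField_eq_sum a hf, vectorField_eq_sum a hg, vectorField_eq_sum a (hf.add hg),
          ← Finset.sum_add_distrib]
        simp only [pd_add f.2 g.2, mul_add]
      map_smul' := fun r f => by
        obtain ⟨s, hf⟩ := f.2
        have hr : SmoothIn s (fun _ : J → ℝ => r) := ⟨fun _ => r, contDiff_const, fun _ => rfl⟩
        have e : ((r • f : smoothFn J) : Fn J) = (fun _ => r) * f.1 := rfl
        apply Subtype.ext
        simp only [e]
        rw [vectorField_eq_sum a (SmoothIn.mul hr hf), RingHom.id_apply, SetLike.val_smul]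
        simp only [vectorField_eq_sum a (s := s) hf, pd_mul (isSmooth_const r) f.2, pd_const,
          mul_zero, add_zero, Finset.smul_sum]
        refine Finset.sum_congr rfl fun v _ => ?_
        funext p
        simp only [Pi.mul_apply, Pi.smul_apply, smul_eq_mul]
        ring }
    fun f g => by
      obtain ⟨s, hf, hg⟩ := IsSmooth.exists_smoothIn f.2 g.2
      apply Subtype.ext
      simp only [LinearMap.coe_mk, AddHom.coe_mk, smul_eq_mul, Subalgebra.coe_add,
        Subalgebra.coe_mul]
      rw [vectorField_eq_sum a hf, vectorField_eq_sum a hg, vectorField_eq_sum a (hf.mul hg),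
        Finset.mul_sum, Finset.mul_sum, ← Finset.sum_add_distrib]
      refine Finset.sum_congr rfl fun v _ => ?_
      rw [pd_mul f.2 g.2]
      ring

@[simp]
theorem coe_fieldDerivation (a : J → Fn J) (ha : ∀ v, IsSmooth (a v)) (f : smoothFn J) :
    (fieldDerivation a ha f : Fn J) = vectorField a f := rfl

open Classical in
theorem vectorField_comp_coord (a : J → Fn J) (A : ℝ → ℝ) (w : J) :
    vectorField a (fun p => A (p w)) = fun p => a w p * deriv A (p w) := by
  funext p
  rw [vectorField, finsum_eq_single _ w]
  · simp [pd_comp_coord]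
  · intro v hv
    simp [pd_comp_coord, hv.symm]

theorem vectorField_coord (a : J → Fn J) (w : J) : vectorField a (fun p => p w) = a w := by
  have h := vectorField_comp_coord a id w
  simpa using h

/-- Leibniz' rule separates a first-order part from a second-order part. The latter is symmetric in
the two fields because partial derivatives commute, so it drops out of the commutator. -/
theorem vectorField_vectorField {a b : J → Fn J} (ha : ∀ v, IsSmooth (a v))
    (hb : ∀ v, IsSmooth (b v)) (hf : SmoothIn s f) :
    vectorField a (vectorField b f) =
      vectorField (fun w => vectorField a (b w)) f +
        ∑ w ∈ s, ∑ v ∈ s, b w * a v * pd v (pd w f) := by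
  have key : vectorField a (vectorField b f) = ∑ w ∈ s,
      (b w * vectorField a (pd w f) + pd w f * vectorField a (b w)) := by
    let B (w : J) : smoothFn J := ⟨b w, hb w⟩
    let P (w : J) : smoothFn J := ⟨pd w f, IsSmooth.pd hf.isSmooth w⟩
    have h := congrArg Subtype.val (map_sum (fieldDerivation a ha) (fun w => B w * P w) s)
    simp only [Derivation.leibniz, smul_eq_mul, coe_fieldDerivation, AddSubmonoidClass.coe_finsetSum,
      Subalgebra.coe_add, Subalgebra.coe_mul] at h
    rw [vectorField_eq_sum b hf]
    exact h
  rw [key, vectorField_eq_sum _ hf, ← Finset.sum_add_distrib]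
  refine Finset.sum_congr rfl fun w _ => ?_
  rw [vectorField_eq_sum a (hf.pd w), Finset.mul_sum, add_comm, mul_comm]
  simp only [mul_assoc]

/-- The commutator of two vector fields. -/
theorem vectorField_bracket {a b : J → Fn J} (ha : ∀ v, IsSmooth (a v))
    (hb : ∀ v, IsSmooth (b v)) (hf : IsSmooth f) :
    vectorField a (vectorField b f) + vectorField (fun w => vectorField b (a w)) f =
      vectorField b (vectorField a f) + vectorField (fun w => vectorField a (b w)) f := by
  obtain ⟨s, hs⟩ := id hf
  rw [vectorField_vectorField ha hb (s := s) hs, vectorField_vectorField hb ha (s := s) hs,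
    Finset.sum_comm (s := s)]
  have : ∀ v w, b w * a v * pd v (pd w f) = a v * b w * pd w (pd v f) := fun v w => by
    rw [pd_comm hf, mul_comm (b w)]
  simp only [this]
  abel

/-- The commutator is again a vector field, so commutation only has to be checked on the
coordinates. -/
theorem vectorField_comm {a b : J → Fn J} (ha : ∀ v, IsSmooth (a v)) (hb : ∀ v, IsSmooth (b v))
    (h : ∀ w, vectorField a (b w) = vectorField b (a w)) (hf : IsSmooth f) :
    vectorField a (vectorField b f) = vectorField b (vectorField a f) := by
  have := vectorField_bracket ha hb hf
  simp only [h] at this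
  exact add_right_cancel this

/-- A smooth function whose partial derivatives vanish except in the coordinate `v` is a smooth
function of that coordinate. -/
theorem exists_eq_comp_coord (hf : IsSmooth f) (v : J) (h : ∀ w, w ≠ v → pd w f = 0) :
    ∃ A : ℝ → ℝ, ContDiff ℝ ∞ A ∧ ∀ p, f p = A (p v) := by
  classical
  obtain ⟨s, g, hg, hfg⟩ := id hf
  have key (p q : J → ℝ) (hpq : p v = q v) : f p = f q := by
    -- Along the segment from `p` to `q` the derivative is a combination of partial derivatives, in
    -- which `∂/∂v` has coefficient `q v - p v = 0`.
    have hd (t : ℝ) : HasDerivAt (fun t : ℝ => f (p + t • (q - p))) 0 t := by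
      have h1 := hasLineDerivAt_of_comp hg hfg (p + t • (q - p)) (q - p)
      have h0 : fderiv ℝ g (fun j => (p + t • (q - p)) j) (fun j : s => (q - p) j) = 0 := by
        have e : (fun j : s => (q - p) j) =
            ∑ w ∈ s, (q - p) w • (fun j : s => (Pi.single w 1 : J → ℝ) j) := by
          funext j
          simp [Finset.sum_apply, Pi.single_apply]
        rw [e, map_sum]
        refine Finset.sum_eq_zero fun w _ => ?_
        rw [map_smul, ← pd_eq_of_comp hg hfg]
        by_cases hw : w = v
        · subst hw
          simp [hpq]
        · simp [h w hw]
      rw [h0] at h1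
      have h2 := HasDerivAt.comp_sub_const t t (by simpa [HasLineDerivAt] using h1)
      refine h2.congr_of_eventuallyEq (Filter.Eventually.of_forall fun r => ?_)
      simp only
      congr 1
      module
    have := is_const_of_deriv_eq_zero (fun t => (hd t).differentiableAt)
      (fun t => (hd t).deriv) 0 1
    simpa using this
  refine ⟨fun r => g fun j => (Pi.single v r : J → ℝ) j, hg.comp (contDiff_pi.2 fun j => ?_),
    fun p => ?_⟩
  · by_cases hj : (j : J) = v
    · simp only [hj, Pi.single_eq_same]
      exact contDiff_id
    · simp only [Pi.single_eq_of_ne hj]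
      exact contDiff_const
  · rw [key p (Pi.single v (p v)) (by simp), hfg]

end Smooth

/-! ### The diagonal resolvent in an abstract differential algebra. -/

section Resolvent

open PowerSeries

variable {A : Type*} [CommRing A] [Algebra ℝ A]

/-- The coefficientwise extension of a derivation to formal power series. -/
def coeffwise (D : Derivation ℝ A A) : Derivation ℝ A⟦X⟧ A⟦X⟧ :=
  Derivation.mk'
    { toFun := fun f => PowerSeries.mk fun n => D (coeff n f)
      map_add' := fun f g => by ext n; simp
      map_smul' := fun r f => by ext n; simp }
    fun f g => by
      ext n
      simp only [LinearMap.coe_mk, AddHom.coe_mk, coeff_mk, smul_eq_mul, map_add, coeff_mul,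
        map_sum, Derivation.leibniz, Finset.sum_add_distrib]
      congr 1
      exact Finset.sum_equiv (Equiv.prodComm ℕ ℕ)
        (fun i => by simp [add_comm]) (fun i _ => by simp)

@[simp]
theorem coeff_coeffwise (D : Derivation ℝ A A) (f : A⟦X⟧) (n : ℕ) :
    coeff n (coeffwise D f) = D (coeff n f) := by
  simp [coeffwise]

@[simp]
theorem coeffwise_C (D : Derivation ℝ A A) (a : A) : coeffwise D (C a) = C (D a) := by
  ext n
  simp only [coeff_coeffwise, coeff_C]
  split_ifs <;> simp

@[simp]
theorem coeffwise_X (D : Derivation ℝ A A) : coeffwise D (X : A⟦X⟧) = 0 := by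
  ext n
  simp only [coeff_coeffwise, coeff_X]
  split_ifs <;> simp

theorem X_pow_dvd_coeffwise (D : Derivation ℝ A A) {f : A⟦X⟧} {n : ℕ} (h : X ^ n ∣ f) :
    X ^ n ∣ coeffwise D f := by
  rw [X_pow_dvd_iff] at h ⊢
  intro m hm
  simp [h m hm]

/-- The coefficients of the diagonal resolvent of the Schrödinger operator with potential `w`. -/
def resolventCoeff (D : Derivation ℝ A A) (w : A) : ℕ → A
  | 0 => 1
  | n + 1 =>
    (∑ i : Fin (n + 1), (2 * w * resolventCoeff D w i * resolventCoeff D w (n - i)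
      - resolventCoeff D w i * D (D (resolventCoeff D w (n - i)))
      + (1 / 2 : ℝ) • (D (resolventCoeff D w i) * D (resolventCoeff D w (n - i)))))
    - (1 / 2 : ℝ) • ∑ i : Fin n, resolventCoeff D w (i + 1) * resolventCoeff D w (n - i)
decreasing_by all_goals omega

/-- The generating series of the resolvent coefficients. -/
def resolvent (D : Derivation ℝ A A) (w : A) : A⟦X⟧ := PowerSeries.mk (resolventCoeff D w)

theorem coeff_resolvent (D : Derivation ℝ A A) (w : A) (n : ℕ) :
    coeff n (resolvent D w) = resolventCoeff D w n := by
  simp [resolvent]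

/-- As the leading coefficient is `1`, the coefficient of `X^(n+1)` on the left contains `b (n+1)`
only through `2 b (n+1)`, while the right side involves `b 0, ..., b n`. The recursive definition of
`resolventCoeff` is this identity solved for `b (n+1)`. -/
theorem resolvent_quadratic (D : Derivation ℝ A A) (w : A) :
    resolvent D w ^ 2 = 1 + X * (4 * C w * resolvent D w ^ 2
      - 2 * resolvent D w * coeffwise D (coeffwise D (resolvent D w))
      + coeffwise D (resolvent D w) ^ 2) := by
  set b := resolventCoeff D w with hb
  have hB (n : ℕ) : coeff n (resolvent D w) = b n := coeff_resolvent D w n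
  have hb0 : b 0 = 1 := by rw [hb, resolventCoeff]
  ext n
  rcases n with _ | n
  · rw [map_add, coeff_zero_X_mul]
    simp [pow_two, coeff_mul, hB, hb0]
  · have h1 : coeff (n + 1) (resolvent D w ^ 2) =
        2 * b (n + 1) + ∑ i : Fin n, b (i + 1) * b (n - i) := by
      rw [pow_two, coeff_mul, Finset.Nat.sum_antidiagonal_eq_sum_range_succ_mk,
        Finset.sum_range_succ, Finset.sum_range_succ', Finset.sum_range]
      simp only [hB, hb0, Nat.sub_self, Nat.sub_zero, Nat.add_sub_add_right]
      ring
    have h2 : (4 * C w * resolvent D w ^ 2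
        - 2 * resolvent D w * coeffwise D (coeffwise D (resolvent D w))
        + coeffwise D (resolvent D w) ^ 2 : A⟦X⟧) =
        C (4 * w) * (resolvent D w * resolvent D w)
        - C 2 * (resolvent D w * coeffwise D (coeffwise D (resolvent D w)))
        + coeffwise D (resolvent D w) * coeffwise D (resolvent D w) := by
      simp only [map_mul, map_ofNat]
      ring
    have h4 (a : A) : 2 * ((1 / 2 : ℝ) • a) = a := by
      rw [two_mul, ← add_smul]
      norm_num
    have h3 : 2 * b (n + 1) = ∑ i : Fin (n + 1), (4 * w * (b i * b (n - i))
        - 2 * (b i * D (D (b (n - i)))) + D (b i) * D (b (n - i)))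
        - ∑ i : Fin n, b (i + 1) * b (n - i) := by
      rw [hb, resolventCoeff, mul_sub, h4, Finset.mul_sum]
      congr 1
      refine Finset.sum_congr rfl fun i _ => ?_
      rw [mul_add, h4]
      ring
    rw [h1, h2, h3, map_add, coeff_succ_X_mul, map_add, map_sub, coeff_C_mul, coeff_C_mul]
    simp only [coeff_mul, coeff_coeffwise, hB, Finset.Nat.sum_antidiagonal_eq_sum_range_succ_mk, Finset.sum_range, coeff_one,
      Finset.sum_add_distrib, Finset.sum_sub_distrib, Finset.mul_sum, Nat.succ_ne_zero, if_false,
      Nat.succ_eq_add_one]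
    ring

theorem isUnit_resolvent (D : Derivation ℝ A A) (w : A) : IsUnit (resolvent D w) := by
  rw [PowerSeries.isUnit_iff_constantCoeff, ← coeff_zero_eq_constantCoeff_apply, coeff_resolvent,
    resolventCoeff]
  exact isUnit_one

theorem eq_of_two_mul_eq {x y : A⟦X⟧} (h : 2 * x = 2 * y) : x = y := by
  have h2 := congrArg (fun z => (1 / 2 : ℝ) • z) h
  simpa [two_mul, ← two_smul ℝ, smul_smul] using h2

/-- The Lenard recursion. -/
theorem resolvent_lenard (D : Derivation ℝ A A) (w : A) :
    coeffwise D (resolvent D w) = X * (4 * C w * coeffwise D (resolvent D w)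
      + 2 * C (D w) * resolvent D w
      - coeffwise D (coeffwise D (coeffwise D (resolvent D w)))) := by
  have h := congrArg (coeffwise D) (resolvent_quadratic D w)
  have hu := isUnit_resolvent D w
  set B := resolvent D w
  have h2 : coeffwise D (2 : A⟦X⟧) = 0 := (coeffwise D).map_natCast 2
  have h4 : coeffwise D (4 : A⟦X⟧) = 0 := (coeffwise D).map_natCast 4
  simp only [pow_two, map_add, map_sub, Derivation.leibniz, smul_eq_mul, h2, h4, coeffwise_C,
    coeffwise_X, Derivation.map_one_eq_zero] at h
  -- The differentiated quadratic identity is `2 B` times the claim.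
  apply hu.mul_left_cancel
  apply eq_of_two_mul_eq
  linear_combination h

/-- The evolution of the resolvent along the flow given by the equation. -/
theorem resolvent_flow (Dt Dx Dy : Derivation ℝ A A) (u : A)
    (hxy : ∀ f, Dx (Dy f) = Dy (Dx f)) (hxt : ∀ f, Dx (Dt f) = Dt (Dx f))
    (hu : Dt (Dx u) = 2 * Dy u * Dx (Dx u) + 4 * Dx u * Dy (Dx u) - Dx (Dx (Dy (Dx u)))) :
    coeffwise Dy (resolvent Dx (Dx u)) = X * (coeffwise Dt (resolvent Dx (Dx u))
      - 2 * C (Dy u) * coeffwise Dx (resolvent Dx (Dx u))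
      + 2 * C (Dy (Dx u)) * resolvent Dx (Dx u)) := by
  have hq := resolvent_quadratic Dx (Dx u)
  have hunit := isUnit_resolvent Dx (Dx u)
  set B := resolvent Dx (Dx u)
  have h2 (D : Derivation ℝ A A) : coeffwise D (2 : A⟦X⟧) = 0 := (coeffwise D).map_natCast 2
  have h4 (D : Derivation ℝ A A) : coeffwise D (4 : A⟦X⟧) = 0 := (coeffwise D).map_natCast 4
  have cxy (f : A⟦X⟧) : coeffwise Dy (coeffwise Dx f) = coeffwise Dx (coeffwise Dy f) := by
    ext n; simp [hxy]
  have cxt (f : A⟦X⟧) : coeffwise Dt (coeffwise Dx f) = coeffwise Dx (coeffwise Dt f) := by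
    ext n; simp [hxt]
  have qx := congrArg (coeffwise Dx) hq
  have qy := congrArg (coeffwise Dy) hq
  have qt := congrArg (coeffwise Dt) hq
  -- The defect of the claimed relation; the goal is `F = 0`.
  set F := coeffwise Dy B - X * (coeffwise Dt B
      - 2 * C (Dy u) * coeffwise Dx B + 2 * C (Dy (Dx u)) * B) with hF
  have hFx := congrArg (coeffwise Dx) hF
  have hFxx := congrArg (coeffwise Dx) hFx
  simp only [pow_two, map_add, map_sub, Derivation.leibniz, smul_eq_mul, h2, h4, coeffwise_C,
    coeffwise_X, Derivation.map_one_eq_zero, map_zero, cxy, cxt, hu, map_mul, map_ofNat,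
    ← hxy u] at qx qy qt hFx hFxx
  -- Apply the derivation `D_y - X D_t + 2 X u_y D_x` to the quadratic identity. After eliminating
  -- `u_tx` by the equation, the inhomogeneous terms cancel.
  have key : B * F = X * (4 * C (Dx u) * B * F - F * coeffwise Dx (coeffwise Dx B)
      - B * coeffwise Dx (coeffwise Dx F) + coeffwise Dx B * coeffwise Dx F) := by
    apply eq_of_two_mul_eq
    rw [hFxx, hFx, hF]
    simp only [← hxy u]
    linear_combination qy - X * qt + 2 * X * C (Dy u) * qx
  -- Coefficientwise derivations preserve divisibility by `X ^ n`, so the explicit factor `X` in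
  -- `key` gains one power each time.
  have hdvd (n : ℕ) : X ^ n ∣ F := by
    induction n with
    | zero => simp
    | succ n ih =>
      rw [← hunit.dvd_mul_left, key, pow_succ']
      have ih1 := X_pow_dvd_coeffwise Dx ih
      have ih2 := X_pow_dvd_coeffwise Dx ih1
      refine mul_dvd_mul_left _ (dvd_add (dvd_sub (dvd_sub ?_ ?_) ?_) ?_)
      · exact ih.mul_left _
      · exact ih.mul_right _
      · exact ih2.mul_left _
      · exact ih1.mul_left _
  have hF0 : F = 0 := by
    ext n
    exact X_pow_dvd_iff.1 (hdvd (n + 1)) n (Nat.lt_succ_self n)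
  rw [hF, sub_eq_zero] at hF0
  exact hF0

theorem lenard_coeff {D : Derivation ℝ A A} {w : A} {S : A⟦X⟧}
    (h : coeffwise D S = X * (4 * C w * coeffwise D S + 2 * C (D w) * S
      - coeffwise D (coeffwise D (coeffwise D S)))) (n : ℕ) :
    D (coeff (n + 1) S) = 4 * w * D (coeff n S) + 2 * D w * coeff n S
      - D (D (D (coeff n S))) := by
  have e : (4 * C w * coeffwise D S + 2 * C (D w) * S : A⟦X⟧) =
      C (4 * w) * coeffwise D S + C (2 * D w) * S := by simp only [map_mul, map_ofNat]
  have h' := congrArg (coeff (n + 1)) h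
  rw [e, coeff_succ_X_mul, map_sub, map_add, coeff_C_mul, coeff_C_mul] at h'
  simpa only [coeff_coeffwise] using h'

theorem flow_coeff {Dt Dx Dy : Derivation ℝ A A} {u : A} {S : A⟦X⟧}
    (h : coeffwise Dy S = X * (coeffwise Dt S - 2 * C (Dy u) * coeffwise Dx S
      + 2 * C (Dy (Dx u)) * S)) (n : ℕ) :
    Dy (coeff (n + 1) S) = Dt (coeff n S) - 2 * Dy u * Dx (coeff n S)
      + 2 * Dy (Dx u) * coeff n S := by
  have e : (coeffwise Dt S - 2 * C (Dy u) * coeffwise Dx S + 2 * C (Dy (Dx u)) * S : A⟦X⟧) =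
      coeffwise Dt S - C (2 * Dy u) * coeffwise Dx S + C (2 * Dy (Dx u)) * S := by
    simp only [map_mul, map_ofNat]
  have h' := congrArg (coeff (n + 1)) h
  rw [e, coeff_succ_X_mul, map_add, map_sub, coeff_C_mul, coeff_C_mul] at h'
  simpa only [coeff_coeffwise] using h'

theorem resolventCoeff_one (D : Derivation ℝ A A) (w : A) : resolventCoeff D w 1 = 2 * w := by
  have h0 : resolventCoeff D w 0 = 1 := by rw [resolventCoeff]
  rw [resolventCoeff]
  simp [h0]

/-- The resolvent coefficients of positive index lie in every differential subalgebra without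
unit that contains the potential. -/
theorem resolventCoeff_mem {D : Derivation ℝ A A} {w : A} (N : NonUnitalSubalgebra ℝ A)
    (hw : w ∈ N) (hD : ∀ f ∈ N, D f ∈ N) (n : ℕ) : resolventCoeff D w (n + 1) ∈ N := by
  induction n using Nat.strong_induction_on with
  | _ n ih =>
    -- The coefficient of index `0` is `1` and need not lie in `N`; it is harmless because it is
    -- either multiplied by an element of `N` or differentiated to zero.
    have hmul (i : ℕ) (hi : i ≤ n) (a : A) (ha : a ∈ N) : a * resolventCoeff D w i ∈ N := by
      rcases i with _ | i
      · simpa [resolventCoeff] using ha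
      · exact mul_mem ha (ih i (by omega))
    have hder (i : ℕ) (hi : i ≤ n) : D (resolventCoeff D w i) ∈ N := by
      rcases i with _ | i
      · simp [resolventCoeff]
      · exact hD _ (ih i (by omega))
    rw [resolventCoeff]
    refine sub_mem (sum_mem fun i _ => add_mem (sub_mem ?_ ?_) ?_) (SMulMemClass.smul_mem _ (sum_mem ?_))
    · refine hmul _ (Nat.sub_le _ _) _ (hmul _ (by omega) _ ?_)
      rw [two_mul]
      exact add_mem hw hw
    · rw [mul_comm]
      exact hmul _ (by omega) _ (hD _ (hder _ (Nat.sub_le _ _)))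
    · exact SMulMemClass.smul_mem _ (mul_mem (hder _ (by omega)) (hder _ (Nat.sub_le _ _)))
    · exact fun i _ => hmul _ (Nat.sub_le _ _) _ (ih i i.2)

/-- Multiplying the resolvent by a series of integration constants. -/
theorem series_mul_resolvent {Dt Dx Dy : Derivation ℝ A A} {u : A}
    (hxy : ∀ f, Dx (Dy f) = Dy (Dx f)) (hxt : ∀ f, Dx (Dt f) = Dt (Dx f))
    (hu : Dt (Dx u) = 2 * Dy u * Dx (Dx u) + 4 * Dx u * Dy (Dx u) - Dx (Dx (Dy (Dx u))))
    (c : ℕ → A) (hcx : ∀ n, Dx (c n) = 0) (hcy : Dy (c 0) = 0)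
    (hcyt : ∀ n, Dy (c (n + 1)) = Dt (c n)) :
    ∃ s : ℕ → A, s 0 = c 0 ∧ ∀ n,
      Dx (s (n + 1)) = 4 * Dx u * Dx (s n) + 2 * Dx (Dx u) * s n - Dx (Dx (Dx (s n))) ∧
      Dy (s (n + 1)) = Dt (s n) - 2 * Dy u * Dx (s n) + 2 * Dy (Dx u) * s n := by
  set K : A⟦X⟧ := PowerSeries.mk c with hK
  -- `K` is a constant both for `D_x` and for `D_y - X D_t`, the derivations through which the two
  -- linear relations act, so these pass from `B` to `K * B`.
  have hKx : coeffwise Dx K = 0 := by ext n; simp [hK, hcx]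
  have hKy : coeffwise Dy K = X * coeffwise Dt K := by
    ext n
    rcases n with _ | n
    · rw [coeff_zero_X_mul]
      simp [hK, hcy]
    · rw [coeff_succ_X_mul]
      simp [hK, hcyt]
  have h1 := resolvent_lenard Dx (Dx u)
  have h2 := resolvent_flow Dt Dx Dy u hxy hxt hu
  have h0 : coeff 0 (resolvent Dx (Dx u)) = 1 := by rw [coeff_resolvent, resolventCoeff]
  set B := resolvent Dx (Dx u)
  refine ⟨fun n => coeff n (K * B), ?_, fun n => ⟨lenard_coeff ?_ n, flow_coeff ?_ n⟩⟩
  · simp [coeff_mul, h0, hK]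
  · simp only [Derivation.leibniz, smul_eq_mul, hKx, mul_zero, add_zero]
    linear_combination K * h1
  · simp only [Derivation.leibniz, smul_eq_mul, hKx, hKy, mul_zero, add_zero]
    linear_combination K * h2

/-- A function to which the recursion operator can be applied is a symmetry. -/
theorem symmetry_of_recursion {Dt Dx Dy : Derivation ℝ A A} {u f g : A}
    (hxy : ∀ f, Dx (Dy f) = Dy (Dx f)) (hxt : ∀ f, Dx (Dt f) = Dt (Dx f))
    (hx : Dx g = 4 * Dx u * Dx f + 2 * Dx (Dx u) * f - Dx (Dx (Dx f)))
    (hy : Dy g = Dt f - 2 * Dy u * Dx f + 2 * Dy (Dx u) * f) :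
    Dt (Dx f) - 2 * Dx (Dx u) * Dy f - 2 * Dy u * Dx (Dx f) - 4 * Dy (Dx u) * Dx f
      - 4 * Dx u * Dx (Dy f) + Dx (Dx (Dx (Dy f))) = 0 := by
  -- Cross-differentiation: with both derivatives of `g` substituted, the compatibility condition is
  -- the linearized equation for `f`.
  have h := hxy g
  have h2 (D : Derivation ℝ A A) : D (2 : A) = 0 := D.map_natCast 2
  have h4 (D : Derivation ℝ A A) : D (4 : A) = 0 := D.map_natCast 4
  rw [hx, hy] at h
  simp only [map_add, map_sub, Derivation.leibniz, smul_eq_mul, h2, h4, ← hxy, hxt] at h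
  simp only [← hxy]
  linear_combination h

end Resolvent

/-! ### Commuting total derivatives on the equation, and their common constants. -/

section Equation

theorem IsSmooth.iterate {F : Fn Coord → Fn Coord} (hF : ∀ f, IsSmooth f → IsSmooth (F f))
    {f : Fn Coord} (hf : IsSmooth f) (n : ℕ) : IsSmooth (F^[n] f) := by
  induction n with
  | zero => exact hf
  | succ n ih =>
    rw [Function.iterate_succ_apply']
    exact hF _ ih

theorem isSmooth_zero {J : Type*} : IsSmooth (0 : Fn J) := isSmooth_const 0

theorem isSmooth_one {J : Type*} : IsSmooth (1 : Fn J) := isSmooth_const 1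

/-- The jet variables as smooth functions. -/
def jet (i j : ℕ) : smoothFn Coord := ⟨U i j, isSmooth_coord _⟩

theorem coe_rhs : rhs = ((2 * jet 0 1 * jet 2 0 + 4 * jet 1 0 * jet 1 1 - jet 3 1 :
    smoothFn Coord) : Fn Coord) := rfl

theorem isSmooth_rhs : IsSmooth rhs := by
  rw [coe_rhs]
  exact Subtype.prop _

theorem isSmooth_yCoeff : ∀ c, IsSmooth (yCoeff c)
  | .t => isSmooth_zero
  | .x => isSmooth_zero
  | .y => isSmooth_one
  | .ux _ _ => isSmooth_coord _
  | .ut _ _ => isSmooth_coord _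

/-- Components of the auxiliary total derivative `Dx₀`. -/
def xCoeff₀ : Coord → Fn Coord
  | .t => 0
  | .x => 1
  | .y => 0
  | .ux i j => fun p => p (.ux (i + 1) j)
  | .ut _ _ => 0

theorem Dx₀_eq : Dx₀ = vectorField xCoeff₀ := by
  unfold Dx₀
  congr 1

theorem isSmooth_xCoeff₀ : ∀ c, IsSmooth (xCoeff₀ c)
  | .t => isSmooth_zero
  | .x => isSmooth_one
  | .y => isSmooth_zero
  | .ux _ _ => isSmooth_coord _
  | .ut _ _ => isSmooth_zero

theorem isSmooth_Dy (f : Fn Coord) (hf : IsSmooth f) : IsSmooth (Dy f) :=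
  IsSmooth.vectorField isSmooth_yCoeff hf

theorem isSmooth_Dx₀ (f : Fn Coord) (hf : IsSmooth f) : IsSmooth (Dx₀ f) := by
  rw [Dx₀_eq]
  exact IsSmooth.vectorField isSmooth_xCoeff₀ hf

theorem isSmooth_tCoeff : ∀ c, IsSmooth (tCoeff c)
  | .t => isSmooth_one
  | .x => isSmooth_zero
  | .y => isSmooth_zero
  | .ux 0 _ => isSmooth_coord _
  | .ux (_ + 1) _ => IsSmooth.iterate isSmooth_Dx₀ (IsSmooth.iterate isSmooth_Dy isSmooth_rhs _) _
  | .ut _ _ => isSmooth_coord _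

theorem isSmooth_Dt (f : Fn Coord) (hf : IsSmooth f) : IsSmooth (Dt f) :=
  IsSmooth.vectorField isSmooth_tCoeff hf

theorem isSmooth_xCoeff : ∀ c, IsSmooth (xCoeff c)
  | .t => isSmooth_zero
  | .x => isSmooth_one
  | .y => isSmooth_zero
  | .ux _ _ => isSmooth_coord _
  | .ut _ _ => IsSmooth.iterate isSmooth_Dt (IsSmooth.iterate isSmooth_Dy isSmooth_rhs _) _

/-- `D_t` as a derivation of the algebra of smooth functions. -/
def derivT : Derivation ℝ (smoothFn Coord) (smoothFn Coord) :=
  fieldDerivation tCoeff isSmooth_tCoeff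

/-- `D_x` as a derivation of the algebra of smooth functions. -/
def derivX : Derivation ℝ (smoothFn Coord) (smoothFn Coord) :=
  fieldDerivation xCoeff isSmooth_xCoeff

/-- `D_y` as a derivation of the algebra of smooth functions. -/
def derivY : Derivation ℝ (smoothFn Coord) (smoothFn Coord) :=
  fieldDerivation yCoeff isSmooth_yCoeff

/-- `Dx₀` as a derivation of the algebra of smooth functions. -/
def derivX₀ : Derivation ℝ (smoothFn Coord) (smoothFn Coord) :=
  fieldDerivation xCoeff₀ isSmooth_xCoeff₀

theorem coe_derivX (f : smoothFn Coord) : (derivX f : Fn Coord) = Dx f := rfl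

theorem coe_derivY (f : smoothFn Coord) : (derivY f : Fn Coord) = Dy f := rfl

theorem coe_derivX₀ (f : smoothFn Coord) : (derivX₀ f : Fn Coord) = Dx₀ f := by
  rw [Dx₀_eq]
  rfl

theorem derivX_jet (i j : ℕ) : derivX (jet i j) = jet (i + 1) j :=
  Subtype.ext (vectorField_coord xCoeff (.ux i j))

theorem derivX₀_jet (i j : ℕ) : derivX₀ (jet i j) = jet (i + 1) j :=
  Subtype.ext (vectorField_coord xCoeff₀ (.ux i j))

theorem derivY_jet (i j : ℕ) : derivY (jet i j) = jet i (j + 1) :=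
  Subtype.ext (vectorField_coord yCoeff (.ux i j))

theorem derivation_mem_adjoin {A : Type*} [CommRing A] [Algebra ℝ A] {s : Set A}
    (D : Derivation ℝ A A) (hD : ∀ a ∈ s, D a ∈ Algebra.adjoin ℝ s) {f : A}
    (hf : f ∈ Algebra.adjoin ℝ s) : D f ∈ Algebra.adjoin ℝ s := by
  induction hf using Algebra.adjoin_induction with
  | mem a ha => exact hD a ha
  | algebraMap r => simp
  | add a b _ _ ha hb => simpa using add_mem ha hb
  | mul a b ha' hb' ha hb => simpa using add_mem (mul_mem ha' hb) (mul_mem hb' ha)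

/-- The algebra of polynomials in the jet variables `∂_x^i ∂_y^j u`. -/
def jetAlgebra : Subalgebra ℝ (smoothFn Coord) :=
  Algebra.adjoin ℝ (Set.range fun i : ℕ × ℕ => jet i.1 i.2)

theorem jet_mem_jetAlgebra (i j : ℕ) : jet i j ∈ jetAlgebra :=
  Algebra.subset_adjoin ⟨(i, j), rfl⟩

theorem derivX₀_mem_jetAlgebra {f : smoothFn Coord} (hf : f ∈ jetAlgebra) :
    derivX₀ f ∈ jetAlgebra := by
  refine derivation_mem_adjoin _ ?_ hf
  rintro _ ⟨i, rfl⟩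
  rw [derivX₀_jet]
  exact jet_mem_jetAlgebra _ _

theorem derivY_mem_jetAlgebra {f : smoothFn Coord} (hf : f ∈ jetAlgebra) :
    derivY f ∈ jetAlgebra := by
  refine derivation_mem_adjoin _ ?_ hf
  rintro _ ⟨i, rfl⟩
  rw [derivY_jet]
  exact jet_mem_jetAlgebra _ _

/-- Two derivations agreeing on generators agree on the generated algebra. `D_t` is built from
`Dx₀`, because `D_x` itself is built from `D_t`; commutation of `D_x` with `D_t` requires exchanging
the two `x`-derivatives on the derivatives of `rhs`. -/
theorem derivX_eq_derivX₀ {f : smoothFn Coord} (hf : f ∈ jetAlgebra) : derivX f = derivX₀ f := by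
  refine Derivation.eqOn_adjoin (s := Set.range fun i : ℕ × ℕ => jet i.1 i.2) ?_ hf
  rintro _ ⟨i, rfl⟩
  simp only [derivX_jet, derivX₀_jet]

theorem exists_coe_eq_iterate (i j : ℕ) :
    ∃ f ∈ jetAlgebra, (f : Fn Coord) = Dx₀^[i] (Dy^[j] rhs) := by
  induction i with
  | zero =>
    induction j with
    | zero =>
      refine ⟨2 * jet 0 1 * jet 2 0 + 4 * jet 1 0 * jet 1 1 - jet 3 1, ?_, rfl⟩
      have h2 : (2 : smoothFn Coord) ∈ jetAlgebra := natCast_mem _ 2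
      have h4 : (4 : smoothFn Coord) ∈ jetAlgebra := natCast_mem _ 4
      have h := jet_mem_jetAlgebra
      exact sub_mem (add_mem (mul_mem (mul_mem h2 (h _ _)) (h _ _))
        (mul_mem (mul_mem h4 (h _ _)) (h _ _))) (h _ _)
    | succ j ih =>
      obtain ⟨f, hf, e⟩ := ih
      refine ⟨derivY f, derivY_mem_jetAlgebra hf, ?_⟩
      rw [coe_derivY, e, Function.iterate_zero, Function.iterate_succ_apply']
      rfl
  | succ i ih =>
    obtain ⟨f, hf, e⟩ := ih
    exact ⟨derivX₀ f, derivX₀_mem_jetAlgebra hf, by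
      rw [coe_derivX₀, e, Function.iterate_succ_apply']⟩

theorem Dx_iterate_rhs (i j : ℕ) : Dx (Dx₀^[i] (Dy^[j] rhs)) = Dx₀^[i + 1] (Dy^[j] rhs) := by
  obtain ⟨f, hf, e⟩ := exists_coe_eq_iterate i j
  rw [Function.iterate_succ_apply', ← e, ← coe_derivX, ← coe_derivX₀, derivX_eq_derivX₀ hf]

theorem vectorField_const {J : Type*} (a : J → Fn J) (r : ℝ) :
    vectorField a (fun _ => r) = 0 := by
  funext p
  simp [vectorField, pd_const]

theorem vectorField_zero {J : Type*} (a : J → Fn J) : vectorField a 0 = 0 := vectorField_const a 0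

theorem vectorField_one {J : Type*} (a : J → Fn J) : vectorField a 1 = 0 := vectorField_const a 1

/-- The base of a ladder: this moves `D_y` through the iterates of `Dx₀` in the components of `D_t`,
whence `D_t` and `D_y` commute; that in turn moves `D_y` through the iterates of `D_t` in the
components of `D_x`. -/
theorem Dx₀_Dy_comm {f : Fn Coord} (hf : IsSmooth f) : Dx₀ (Dy f) = Dy (Dx₀ f) := by
  rw [Dx₀_eq]
  refine vectorField_comm isSmooth_xCoeff₀ isSmooth_yCoeff (fun c => ?_) hf
  cases c <;> simp [xCoeff₀, yCoeff, vectorField_coord, vectorField_zero, vectorField_one]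

theorem Dy_iterate_Dx₀ (i j : ℕ) : Dy (Dx₀^[i] (Dy^[j] rhs)) = Dx₀^[i] (Dy^[j + 1] rhs) := by
  induction i with
  | zero => simp only [Function.iterate_zero, id, Function.iterate_succ_apply']
  | succ i ih =>
    have h := IsSmooth.iterate isSmooth_Dx₀ (IsSmooth.iterate isSmooth_Dy isSmooth_rhs j) i
    rw [Function.iterate_succ_apply', ← Dx₀_Dy_comm h, ih, ← Function.iterate_succ_apply' Dx₀]

theorem Dt_Dy_comm {f : Fn Coord} (hf : IsSmooth f) : Dt (Dy f) = Dy (Dt f) := by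
  refine vectorField_comm isSmooth_tCoeff isSmooth_yCoeff (fun c => ?_) hf
  rcases c with _ | _ | _ | ⟨_ | i, j⟩ | ⟨i, j⟩
  case ux.succ => exact (vectorField_coord tCoeff _).trans (Dy_iterate_Dx₀ i j).symm
  all_goals simp [tCoeff, yCoeff, vectorField_coord, vectorField_zero, vectorField_one]

theorem Dy_iterate_Dt (i j : ℕ) : Dy (Dt^[i] (Dy^[j] rhs)) = Dt^[i] (Dy^[j + 1] rhs) := by
  induction i with
  | zero => simp only [Function.iterate_zero, id, Function.iterate_succ_apply']
  | succ i ih =>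
    have h := IsSmooth.iterate isSmooth_Dt (IsSmooth.iterate isSmooth_Dy isSmooth_rhs j) i
    rw [Function.iterate_succ_apply', ← Dt_Dy_comm h, ih, ← Function.iterate_succ_apply' Dt]

theorem Dx_Dy_comm {f : Fn Coord} (hf : IsSmooth f) : Dx (Dy f) = Dy (Dx f) := by
  refine vectorField_comm isSmooth_xCoeff isSmooth_yCoeff (fun c => ?_) hf
  rcases c with _ | _ | _ | ⟨i, j⟩ | ⟨i, j⟩
  case ut => exact (vectorField_coord xCoeff _).trans (Dy_iterate_Dt i j).symm
  all_goals simp [xCoeff, yCoeff, vectorField_coord, vectorField_zero, vectorField_one]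

theorem Dx_Dt_comm {f : Fn Coord} (hf : IsSmooth f) : Dx (Dt f) = Dt (Dx f) := by
  refine vectorField_comm isSmooth_xCoeff isSmooth_tCoeff (fun c => ?_) hf
  rcases c with _ | _ | _ | ⟨_ | i, j⟩ | ⟨i, j⟩
  case ux.succ => exact (Dx_iterate_rhs i j).trans (vectorField_coord tCoeff (.ux (i + 2) j)).symm
  case ut =>
    refine (vectorField_coord xCoeff _).trans ?_
    exact Function.iterate_succ_apply' Dt i _
  all_goals simp [xCoeff, tCoeff, vectorField_coord, vectorField_zero, vectorField_one]

theorem derivX_derivY (f : smoothFn Coord) : derivX (derivY f) = derivY (derivX f) :=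
  Subtype.ext (Dx_Dy_comm f.2)

theorem derivX_derivT (f : smoothFn Coord) : derivX (derivT f) = derivT (derivX f) :=
  Subtype.ext (Dx_Dt_comm f.2)

theorem derivT_derivX_jet : derivT (derivX (jet 0 0)) =
    2 * derivY (jet 0 0) * derivX (derivX (jet 0 0))
      + 4 * derivX (jet 0 0) * derivY (derivX (jet 0 0))
      - derivX (derivX (derivY (derivX (jet 0 0)))) := by
  simp only [derivX_jet, derivY_jet]
  exact Subtype.ext (vectorField_coord tCoeff (.ux 1 0))

open Classical in
theorem pd_eq_vectorField {J : Type*} (v : J) :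
    pd v = vectorField fun w _ => if w = v then 1 else 0 := by
  funext f p
  rw [vectorField, finsum_eq_single _ v]
  · simp
  · intro w hw
    simp [hw]

/-- The commutator formula with the constant field `∂/∂v`. -/
theorem pd_vectorField {J : Type*} {a : J → Fn J} (ha : ∀ v, IsSmooth (a v)) {f : Fn J}
    (hf : IsSmooth f) (v : J) :
    pd v (vectorField a f) = vectorField a (pd v f) + vectorField (fun w => pd v (a w)) f := by
  classical
  have h := vectorField_bracket (a := fun w _ => if w = v then (1 : ℝ) else 0) (b := a)
    (fun w => isSmooth_const _) ha hf
  rw [← pd_eq_vectorField] at h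
  have h0 : vectorField (fun w => vectorField a fun _ => if w = v then (1 : ℝ) else 0) f = 0 := by
    funext p
    simp only [vectorField_const]
    simp [vectorField]
  rw [h0, add_zero] at h
  exact h

open Classical in
theorem pd_coord {J : Type*} (v w : J) :
    pd v (fun p : J → ℝ => p w) = fun _ => if w = v then 1 else 0 := by
  have h := pd_comp_coord id v w
  simpa using h

theorem pd_zero {J : Type*} (v : J) : pd v 0 = 0 := pd_const 0 v

theorem pd_one {J : Type*} (v : J) : pd v 1 = 0 := pd_const 1 v

-- Here `c 0, c 1, ...` is a chain of coordinates along which `D_y` raises the index, so that `[∂/∂c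
-- (j+1), D_y] = ∂/∂c j`. If `D_y f = 0`, independence of `c (j+1)` thus implies independence of `c
-- j`, and `f` is independent of `c j` for all large `j`.
open Classical in
theorem pd_eq_zero_of_Dy_eq_zero {f : Fn Coord} (hf : IsSmooth f) (hy : Dy f = 0) {c : ℕ → Coord}
    (hc : Function.Injective c)
    (hpd : ∀ j w p, pd (c (j + 1)) (yCoeff w) p = if w = c j then 1 else 0) (j : ℕ) :
    pd (c j) f = 0 := by
  classical
  obtain ⟨s, hs⟩ := id hf
  have hlarge : ∃ n, ∀ j, n ≤ j → c j ∉ s := by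
    refine ⟨(s.preimage c hc.injOn).sup id + 1, fun j hj hmem => ?_⟩
    have := Finset.le_sup (f := id) (Finset.mem_preimage.2 hmem : j ∈ s.preimage c hc.injOn)
    simp only [id] at this hj
    omega
  have hstep (j : ℕ) (h : pd (c (j + 1)) f = 0) : pd (c j) f = 0 := by
    have e := pd_vectorField isSmooth_yCoeff hf (c (j + 1))
    change pd (c (j + 1)) (Dy f) = _ at e
    rw [hy, h, vectorField_zero, zero_add] at e
    have e' : (fun w => pd (c (j + 1)) (yCoeff w)) = fun w _ => if w = c j then 1 else 0 := by
      funext w p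
      rw [hpd]
    rw [e'] at e
    rw [pd_eq_vectorField]
    convert e.symm.trans (pd_const 0 _) using 4
  obtain ⟨n, hn⟩ := hlarge
  rcases le_total n j with h | h
  · exact SmoothIn.pd_eq_zero hs (hn j h)
  · exact Nat.decreasingInduction' (P := fun j => pd (c j) f = 0) (fun k _ _ hk => hstep k hk) h
      (SmoothIn.pd_eq_zero hs (hn n le_rfl))

/-- The only functions on the equation annihilated by `D_x` and `D_y` are the functions of `t`. -/
theorem exists_eq_comp_t {f : Fn Coord} (hf : IsSmooth f) (hx : Dx f = 0) (hy : Dy f = 0) :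
    ∃ A : ℝ → ℝ, ContDiff ℝ ∞ A ∧ ∀ p, f p = A (p .t) := by
  classical
  have hux (i j : ℕ) : pd (.ux i j) f = 0 := by
    refine pd_eq_zero_of_Dy_eq_zero hf hy (c := fun j => .ux i j)
      (fun a b h => by simpa using h) (fun j w p => ?_) j
    cases w <;> simp [yCoeff, pd_coord, pd_zero, pd_one]
  have hut (i j : ℕ) : pd (.ut i j) f = 0 := by
    refine pd_eq_zero_of_Dy_eq_zero hf hy (c := fun j => .ut i j)
      (fun a b h => by simpa using h) (fun j w p => ?_) j
    cases w <;> simp [yCoeff, pd_coord, pd_zero, pd_one]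
  -- With no jet variables left in `f`, the total derivatives reduce to the partial ones.
  have hpy : pd .y f = 0 := by
    rw [← hy]
    funext p
    rw [Dy, vectorField, finsum_eq_single _ Coord.y]
    · simp [yCoeff]
    · rintro (_ | _ | _ | _ | _) h <;> simp_all [yCoeff]
  have hpx : pd .x f = 0 := by
    rw [← hx]
    funext p
    rw [Dx, vectorField, finsum_eq_single _ Coord.x]
    · simp [xCoeff]
    · rintro (_ | _ | _ | _ | _) h <;> simp_all [xCoeff]
  refine exists_eq_comp_coord hf .t ?_
  rintro (_ | _ | _ | _ | _) h
  · exact absurd rfl h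
  · exact hpx
  · exact hpy
  · exact hux _ _
  · exact hut _ _

end Equation

/-! ### Infinite local chains of the recursion operator. -/

section Recursion

theorem R₀_iff (f g : smoothFn Coord) : R₀ f g ↔
    derivX g = 4 * derivX (jet 0 0) * derivX f + 2 * derivX (derivX (jet 0 0)) * f
      - derivX (derivX (derivX f)) ∧
    derivY g = derivT f - 2 * derivY (jet 0 0) * derivX f
      + 2 * derivY (derivX (jet 0 0)) * f := by
  simp only [derivX_jet, derivY_jet, zero_add]
  exact ⟨fun h => ⟨Subtype.ext h.1, Subtype.ext h.2⟩,
    fun h => ⟨congrArg Subtype.val h.1, congrArg Subtype.val h.2⟩⟩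

theorem R₀.add {f g f' g' : smoothFn Coord} (h : R₀ f g) (h' : R₀ f' g') :
    R₀ (f + f' : smoothFn Coord) (g + g' : smoothFn Coord) := by
  rw [R₀_iff] at *
  simp only [map_add]
  exact ⟨by linear_combination h.1 + h'.1, by linear_combination h.2 + h'.2⟩

theorem R₀.smul {f g : smoothFn Coord} (h : R₀ f g) (r : ℝ) :
    R₀ (r • f : smoothFn Coord) (r • g : smoothFn Coord) := by
  rw [R₀_iff] at *
  simp only [Derivation.map_smul, h.1, h.2, smul_add, smul_sub, mul_smul_comm, and_self]

/-- A function of `t` on the equation. -/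
def timeFn {A : ℝ → ℝ} (hA : ContDiff ℝ ∞ A) : smoothFn Coord :=
  ⟨fun p => A (p .t), isSmooth_comp_coord hA _⟩

theorem derivX_timeFn {A : ℝ → ℝ} (hA : ContDiff ℝ ∞ A) : derivX (timeFn hA) = 0 :=
  Subtype.ext ((vectorField_comp_coord xCoeff A .t).trans (by funext p; simp [xCoeff]))

theorem derivY_timeFn {A : ℝ → ℝ} (hA : ContDiff ℝ ∞ A) : derivY (timeFn hA) = 0 :=
  Subtype.ext ((vectorField_comp_coord yCoeff A .t).trans (by funext p; simp [yCoeff]))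

theorem derivT_timeFn {A : ℝ → ℝ} (hA : ContDiff ℝ ∞ A) (hA' : ContDiff ℝ ∞ (deriv A)) :
    derivT (timeFn hA) = timeFn hA' :=
  Subtype.ext ((vectorField_comp_coord tCoeff A .t).trans (by funext p; simp [tCoeff, timeFn]))

/-- Two results of applying the recursion operator differ by a function of `t`. -/
theorem R₀.eq_add_timeFn {f g g' : smoothFn Coord} (h : R₀ f g) (h' : R₀ f g') :
    ∃ (A : ℝ → ℝ) (hA : ContDiff ℝ ∞ A), g' = g + timeFn hA := by
  rw [R₀_iff] at h h'
  have hx : derivX (g' - g) = 0 := by rw [map_sub, h.1, h'.1, sub_self]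
  have hy : derivY (g' - g) = 0 := by rw [map_sub, h.2, h'.2, sub_self]
  obtain ⟨A, hA, e⟩ := exists_eq_comp_t (g' - g).2 (congrArg Subtype.val hx)
    (congrArg Subtype.val hy)
  refine ⟨A, hA, ?_⟩
  rw [← sub_eq_iff_eq_add']
  exact Subtype.ext (funext e)

/-- The recursion operator can be iterated on `f` indefinitely in local functions. -/
def Iterable (f : smoothFn Coord) : Prop :=
  ∃ s : ℕ → smoothFn Coord, s 0 = f ∧ ∀ n, R₀ (s n) (s (n + 1))

theorem Iterable.exists_next {f : smoothFn Coord} (h : Iterable f) : ∃ g, Iterable g ∧ R₀ f g := by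
  obtain ⟨s, rfl, hs⟩ := h
  exact ⟨s 1, ⟨fun n => s (n + 1), rfl, fun n => hs (n + 1)⟩, hs 0⟩

theorem Iterable.add {f g : smoothFn Coord} (hf : Iterable f) (hg : Iterable g) :
    Iterable (f + g) := by
  obtain ⟨s, rfl, hs⟩ := hf
  obtain ⟨s', rfl, hs'⟩ := hg
  exact ⟨s + s', rfl, fun n => (hs n).add (hs' n)⟩

theorem Iterable.smul {f : smoothFn Coord} (hf : Iterable f) (r : ℝ) : Iterable (r • f) := by
  obtain ⟨s, rfl, hs⟩ := hf
  exact ⟨r • s, rfl, fun n => (hs n).smul r⟩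

/-- The constant of integration must itself be carried through all later steps. The resolvent is
multiplied by a series with leading coefficient `A(t)`, whose higher coefficients depend on `y` as
well as on `t`. -/
theorem iterable_timeFn {A : ℝ → ℝ} (hA : ContDiff ℝ ∞ A) : Iterable (timeFn hA) := by
  let Y : smoothFn Coord := ⟨fun p => p .y, isSmooth_coord _⟩
  let T (n : ℕ) : smoothFn Coord := timeFn (hA.iterate_deriv n)
  have hYx : derivX Y = 0 := Subtype.ext (vectorField_coord xCoeff .y)
  have hYy : derivY Y = 1 := Subtype.ext (vectorField_coord yCoeff .y)
  have hYt : derivT Y = 0 := Subtype.ext (vectorField_coord tCoeff .y)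
  have hT (n : ℕ) : derivT (T n) = T (n + 1) := by
    have e : deriv (deriv^[n] A) = deriv^[n + 1] A := (Function.iterate_succ_apply' _ _ _).symm
    rw [derivT_timeFn _ (e ▸ hA.iterate_deriv (n + 1))]
    simp only [e, T]
  obtain ⟨s, h0, hs⟩ := series_mul_resolvent derivX_derivY derivX_derivT derivT_derivX_jet
    -- The coefficients `yⁿ/n! · A⁽ⁿ⁾(t)` solve `∂_y c (n+1) = ∂_t c n` with `c 0 = A`.
    (fun n => (n.factorial : ℝ)⁻¹ • (Y ^ n * T n))
    (fun n => by simp [Derivation.leibniz, Derivation.leibniz_pow, hYx, T, derivX_timeFn])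
    (by simp [T, derivY_timeFn])
    (fun n => by
      simp only [Derivation.map_smul, Derivation.leibniz, Derivation.leibniz_pow, hYy, hYt, T,
        derivY_timeFn, smul_zero, zero_add, add_zero, Nat.add_sub_cancel]
      rw [hT]
      simp only [smul_eq_mul, mul_one, mul_smul_comm]
      rw [← Nat.cast_smul_eq_nsmul ℝ, smul_smul, mul_comm (Y ^ n)]
      congr 1
      rw [Nat.factorial_succ]
      push_cast
      field_simp)
  exact ⟨s, by simpa [T] using h0, fun n => (R₀_iff _ _).2 (hs n)⟩

/-- The resolvent coefficients of positive index, which start with `u_x`. -/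
def hierarchy (n : ℕ) : smoothFn Coord :=
  -- The resolvent coefficient of index `1` is `2 u_x`.
  (1 / 2 : ℝ) • resolventCoeff derivX (derivX (jet 0 0)) (n + 1)

theorem R₀_hierarchy (n : ℕ) : R₀ (hierarchy n) (hierarchy (n + 1)) := by
  refine R₀.smul ((R₀_iff _ _).2 ?_) _
  simp only [← coeff_resolvent]
  exact ⟨lenard_coeff (resolvent_lenard _ _) _,
    flow_coeff (resolvent_flow _ _ _ _ derivX_derivY derivX_derivT derivT_derivX_jet) _⟩

theorem hierarchy_zero : hierarchy 0 = jet 1 0 := by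
  rw [hierarchy, resolventCoeff_one, derivX_jet, two_mul, ← two_smul ℝ, smul_smul]
  norm_num

theorem iterable_jet : Iterable (jet 1 0) := ⟨hierarchy, hierarchy_zero, R₀_hierarchy⟩

theorem Iterable.isLocalSymmetry {f : smoothFn Coord} (h : Iterable f) : IsLocalSymmetry f := by
  obtain ⟨g, -, hg⟩ := h.exists_next
  rw [R₀_iff] at hg
  have := symmetry_of_recursion derivX_derivY derivX_derivT hg.1 hg.2
  simp only [derivX_jet, derivY_jet] at this
  exact ⟨f.2, congrArg Subtype.val this⟩

/-- Any result differs from the one in a given infinite chain by a function of `t`, which starts an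
infinite chain too. Thus no choice of constants can obstruct later steps. -/
theorem Iterable.next {f g : smoothFn Coord} (h : Iterable f) (hg : R₀ f (-g : smoothFn Coord)) :
    Iterable g := by
  obtain ⟨g', hg', hfg'⟩ := h.exists_next
  obtain ⟨A, hA, e⟩ := hfg'.eq_add_timeFn hg
  have := (hg'.add (iterable_timeFn hA)).smul (-1)
  rwa [← e, neg_one_smul, neg_neg] at this

theorem vanishesAtZero_hierarchy (n : ℕ) : VanishesAtZero (hierarchy n) := by
  -- Polynomials without constant term in the `x`-derivatives of `u`; all of them vanish on the zero
  -- solution.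
  let N := NonUnitalAlgebra.adjoin ℝ (Set.range fun i => jet i 0)
  have hjet (i : ℕ) : jet i 0 ∈ N := NonUnitalAlgebra.subset_adjoin ℝ ⟨i, rfl⟩
  have hD (f) (hf : f ∈ N) : derivX f ∈ N := by
    induction hf using NonUnitalAlgebra.adjoin_induction with
    | mem a ha =>
      obtain ⟨i, rfl⟩ := ha
      simpa only [derivX_jet] using hjet (i + 1)
    | add a b _ _ ha hb => simpa using add_mem ha hb
    | zero => simp
    | mul a b ha' hb' ha hb => simpa using add_mem (mul_mem ha' hb) (mul_mem hb' ha)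
    | smul r a _ ha => simpa using SMulMemClass.smul_mem r ha
  have hmem : hierarchy n ∈ N := by
    refine SMulMemClass.smul_mem _ (resolventCoeff_mem N ?_ hD n)
    rw [derivX_jet]
    exact hjet 1
  intro p hux _
  generalize hierarchy n = f at hmem ⊢
  induction hmem using NonUnitalAlgebra.adjoin_induction with
  | mem a ha =>
    obtain ⟨i, rfl⟩ := ha
    exact hux i 0
  | add a b _ _ ha hb => simp [ha, hb]
  | zero => rfl
  | mul a b _ _ ha hb => simp [ha]
  | smul r a _ ha => simp [ha]

end Recursion

/-! ### Comparison of local functions with functions on a covering. -/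

section Pullback

variable {ι : Type*}

theorem SmoothIn.pullback {s : Finset Coord} {f : Fn Coord} (h : SmoothIn s f) :
    SmoothIn (s.map .inl) (pullback f : Fn (Coord ⊕ ι)) := by
  obtain ⟨g, hg, hf⟩ := h
  refine ⟨fun q => g fun j => q ⟨.inl j, by simp⟩, hg.comp ?_, fun p => hf _⟩
  exact contDiff_pi.2 fun j => contDiff_apply ℝ ℝ _

theorem IsSmooth.pullback {f : Fn Coord} (h : IsSmooth f) :
    IsSmooth (CBS.pullback f : Fn (Coord ⊕ ι)) :=
  let ⟨_, h⟩ := h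
  (SmoothIn.pullback h).isSmooth

theorem pd_inl_pullback (c : Coord) (f : Fn Coord) :
    pd (Sum.inl c) (pullback f : Fn (Coord ⊕ ι)) = pullback (pd c f) := by
  classical
  funext p
  simp only [pd, lineDeriv, pullback]
  congr 1
  funext t
  congr 1
  funext d
  simp [Pi.single_apply]

/-- A pulled-back function does not involve the nonlocal variables, so the components `X` do not act
on it. -/
theorem liftField_pullback (a : Coord → Fn Coord) (X : ι → Fn (Coord ⊕ ι)) {f : Fn Coord}
    (hf : IsSmooth f) : liftField a X (pullback f) = pullback (vectorField a f) := by
  obtain ⟨s, hs⟩ := hf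
  rw [liftField, vectorField_eq_sum _ (SmoothIn.pullback hs), vectorField_eq_sum a hs,
    Finset.sum_map]
  funext p
  simp [pd_inl_pullback, pullback]

namespace Covering

variable (τ : Covering ι)

theorem R₀_pullback {f g : Fn Coord} (hf : IsSmooth f) (hg : IsSmooth g) (h : CBS.R₀ f g) :
    τ.R₀ (pullback f) (pullback g) := by
  have hx (f : Fn Coord) (hf : IsSmooth f) : τ.Dx (pullback f) = pullback (CBS.Dx f) :=
    liftField_pullback _ _ hf
  have hsx (f : Fn Coord) (hf : IsSmooth f) : IsSmooth (CBS.Dx f) :=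
    IsSmooth.vectorField isSmooth_xCoeff hf
  have hy : τ.Dy (pullback g) = pullback (CBS.Dy g) := liftField_pullback _ _ hg
  have ht : τ.Dt (pullback f) = pullback (CBS.Dt f) := liftField_pullback _ _ hf
  rw [R₀, hy, ht, hx g hg, hx f hf, hx _ (hsx f hf), hx _ (hsx _ (hsx f hf)), h.1, h.2]
  exact ⟨rfl, rfl⟩

theorem isSmooth_elim {a : Coord → Fn Coord} {X : ι → Fn (Coord ⊕ ι)} (ha : ∀ c, IsSmooth (a c))
    (hX : ∀ α, IsSmooth (X α)) (v : Coord ⊕ ι) :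
    IsSmooth (Sum.elim (fun c => pullback (a c)) X v) := by
  rcases v with c | α
  · exact (ha c).pullback
  · exact hX α

/-- If the recursion operator can be applied to a local function with local result, then every
result in a covering with trivial constants is local up to a function of `t`. -/
theorem R₀.eq_pullback {τ : Covering ι} (hτ : τ.OnlyTrivialConstants) {f g : smoothFn Coord}
    (h : CBS.R₀ f g) {Ψ : Fn (Coord ⊕ ι)} (hΨ : IsSmooth Ψ) (h' : τ.R₀ (pullback f) Ψ) :
    ∃ (A : ℝ → ℝ) (hA : ContDiff ℝ ∞ A),
      Ψ = pullback ((g + timeFn hA : smoothFn Coord) : Fn Coord) := by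
  have hp := τ.R₀_pullback f.2 g.2 h
  let G : smoothFn (Coord ⊕ ι) := ⟨pullback g, IsSmooth.pullback g.2⟩
  let P : smoothFn (Coord ⊕ ι) := ⟨Ψ, hΨ⟩
  have hx : τ.Dx (P - G : smoothFn (Coord ⊕ ι)) = 0 := by
    have e := congrArg Subtype.val
      (map_sub (fieldDerivation _ (isSmooth_elim isSmooth_xCoeff τ.smooth_x)) P G)
    refine e.trans ?_
    change τ.Dx Ψ - τ.Dx (pullback g) = 0
    rw [h'.1, hp.1, sub_self]
  have hy : τ.Dy (P - G : smoothFn (Coord ⊕ ι)) = 0 := by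
    have e := congrArg Subtype.val
      (map_sub (fieldDerivation _ (isSmooth_elim isSmooth_yCoeff τ.smooth_y)) P G)
    refine e.trans ?_
    change τ.Dy Ψ - τ.Dy (pullback g) = 0
    rw [h'.2, hp.2, sub_self]
  obtain ⟨A, hA, e⟩ := hτ _ (P - G).2 hx hy
  refine ⟨A, hA, funext fun p => ?_⟩
  have := e p
  change Ψ p - pullback g p = _ at this
  exact sub_eq_iff_eq_add'.1 this

end Covering

end Pullback

/-! ### The three assertions of the proposition. -/

theorem exists_normalized_hierarchy : ∃ χ : ℕ → Fn Coord,
    ((∀ k, IsSmooth (χ k)) ∧ χ 0 = U 1 0 ∧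
      (∀ k, R₀ (χ k) (-χ (k + 1))) ∧ (∀ k, VanishesAtZero (χ k))) ∧
    (∀ k, IsLocalSymmetry (χ k)) ∧
    ∀ χ' : ℕ → Fn Coord,
      ((∀ k, IsSmooth (χ' k)) ∧ χ' 0 = U 1 0 ∧
        (∀ k, R₀ (χ' k) (-χ' (k + 1))) ∧ (∀ k, VanishesAtZero (χ' k))) →
      χ' = χ := by
  -- The alternating sign turns the recursion of `hierarchy` into the one with a minus sign.
  let χ (k : ℕ) : smoothFn Coord := (-1 : ℝ) ^ k • hierarchy k
  have hχ0 : χ 0 = jet 1 0 := by simp [χ, hierarchy_zero]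
  have hR (k : ℕ) : R₀ (χ k) (-χ (k + 1) : smoothFn Coord) := by
    have h := (R₀_hierarchy k).smul ((-1 : ℝ) ^ k)
    simpa [χ, pow_succ] using h
  have hv (k : ℕ) : VanishesAtZero (χ k) := fun p hx ht => by
    have := vanishesAtZero_hierarchy k p hx ht
    simp [χ, this]
  have hit (k : ℕ) : Iterable (χ k) := by
    induction k with
    | zero => rw [hχ0]; exact iterable_jet
    | succ k ih => exact ih.next (hR k)
  refine ⟨fun k => χ k, ⟨fun k => (χ k).2, congrArg Subtype.val hχ0, hR, hv⟩,
    fun k => (hit k).isLocalSymmetry, ?_⟩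
  rintro χ' ⟨hs, h0, hR', hv'⟩
  funext k
  induction k with
  | zero => exact h0.trans (congrArg Subtype.val hχ0).symm
  | succ k ih =>
    let F : smoothFn Coord := ⟨χ' (k + 1), hs (k + 1)⟩
    have h1 : R₀ (χ k) (-F : smoothFn Coord) := ih ▸ hR' k
    obtain ⟨A, hA, e⟩ := (hR k).eq_add_timeFn h1
    have e' (p : Coord → ℝ) : -χ' (k + 1) p = -(χ (k + 1) : Fn Coord) p + A (p .t) :=
      congrFun (congrArg Subtype.val e) p
    -- Evaluation on the zero solution at time `t` isolates the constant of integration.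
    have hA0 (t : ℝ) : A t = 0 := by
      let p : Coord → ℝ := fun c => match c with
        | .t => t
        | _ => 0
      have := e' p
      rw [hv' (k + 1) p (fun _ _ => rfl) (fun _ _ => rfl),
        hv (k + 1) p (fun _ _ => rfl) (fun _ _ => rfl)] at this
      simpa [p] using this.symm
    funext p
    have := e' p
    rw [hA0, add_zero] at this
    exact neg_injective this

theorem exists_next_local (n : ℕ) (χ : ℕ → Fn Coord) (hs : ∀ k ≤ n, IsSmooth (χ k))
    (h0 : χ 0 = U 1 0) (hR : ∀ k < n, R₀ (χ k) (-χ (k + 1))) :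
    ∃ ψ : Fn Coord, IsLocalSymmetry ψ ∧ R₀ (χ n) (-ψ) := by
  have key (k : ℕ) (hk : k ≤ n) : ∃ f : smoothFn Coord, χ k = f ∧ Iterable f := by
    induction k with
    | zero => exact ⟨jet 1 0, h0, iterable_jet⟩
    | succ k ih =>
      obtain ⟨f, e, hf⟩ := ih (by omega)
      refine ⟨⟨χ (k + 1), hs _ hk⟩, rfl, hf.next ?_⟩
      have := hR k hk
      rwa [e] at this
  obtain ⟨f, e, hf⟩ := key n le_rfl
  obtain ⟨g, hg, hfg⟩ := hf.exists_next
  refine ⟨((-1 : ℝ) • g : smoothFn Coord), (hg.smul (-1)).isLocalSymmetry, ?_⟩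
  rw [e]
  simpa using hfg

theorem Covering.exists_local {ι : Type*} (τ : Covering ι) (hτ : τ.OnlyTrivialConstants) (n : ℕ)
    (χ : ℕ → Fn (Coord ⊕ ι)) (hs : ∀ k ≤ n, IsSmooth (χ k)) (h0 : χ 0 = pullback (U 1 0))
    (hR : ∀ k < n, τ.R₀ (χ k) (-χ (k + 1))) (k : ℕ) (hk : k ≤ n) :
    ∃ f : Fn Coord, IsLocalSymmetry f ∧ χ k = pullback f := by
  -- Being the pullback of a function that starts an infinite local chain is preserved at each step:
  -- the covering result is the pullback of the next chain member plus a function of `t`, up to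
  -- sign.
  have key (k : ℕ) (hk : k ≤ n) :
      ∃ f : smoothFn Coord, χ k = pullback (f : Fn Coord) ∧ Iterable f := by
    induction k with
    | zero => exact ⟨jet 1 0, h0, iterable_jet⟩
    | succ k ih =>
      obtain ⟨f, e, hf⟩ := ih (by omega)
      obtain ⟨g, hg, hfg⟩ := hf.exists_next
      have h := hR k hk
      rw [e] at h
      obtain ⟨A, hA, e'⟩ := Covering.R₀.eq_pullback hτ hfg
        ((smoothFn (Coord ⊕ ι)).neg_mem (hs _ hk)) h
      refine ⟨(-1 : ℝ) • (g + timeFn hA), ?_, (hg.add (iterable_timeFn hA)).smul (-1)⟩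
      rw [← neg_neg (χ (k + 1)), e', neg_one_smul]
      rfl
  obtain ⟨f, e, hf⟩ := key k hk
  exact ⟨f, hf.isLocalSymmetry, e⟩

end CBS

end

theorem mainTheorem6 :
    -- The normalized hierarchy (the `k`-th term is `χ_{2k+1}`) exists in local functions, is
    -- unique, and consists of symmetries.
    (∃ χ : ℕ → CBS.Fn CBS.Coord,
      ((∀ k, CBS.IsSmooth (χ k)) ∧ χ 0 = CBS.U 1 0 ∧
        (∀ k, CBS.R₀ (χ k) (-χ (k + 1))) ∧ (∀ k, CBS.VanishesAtZero (χ k))) ∧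
      (∀ k, CBS.IsLocalSymmetry (χ k)) ∧
      ∀ χ' : ℕ → CBS.Fn CBS.Coord,
        ((∀ k, CBS.IsSmooth (χ' k)) ∧ χ' 0 = CBS.U 1 0 ∧
          (∀ k, CBS.R₀ (χ' k) (-χ' (k + 1))) ∧ (∀ k, CBS.VanishesAtZero (χ' k))) →
        χ' = χ) ∧
    -- However the constants of integration have been chosen so far, the next step is again local.
    (∀ (n : ℕ) (χ : ℕ → CBS.Fn CBS.Coord), (∀ k ≤ n, CBS.IsSmooth (χ k)) → χ 0 = CBS.U 1 0 →
      (∀ k < n, CBS.R₀ (χ k) (-χ (k + 1))) →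
      ∃ ψ : CBS.Fn CBS.Coord, CBS.IsLocalSymmetry ψ ∧ CBS.R₀ (χ n) (-ψ)) ∧
    -- Iterating in a covering does not produce any dependence on nonlocal variables.
    (∀ (ι : Type*) (τ : CBS.Covering ι), τ.OnlyTrivialConstants →
      ∀ (n : ℕ) (χ : ℕ → CBS.Fn (CBS.Coord ⊕ ι)), (∀ k ≤ n, CBS.IsSmooth (χ k)) →
        χ 0 = CBS.pullback (CBS.U 1 0) →
        (∀ k < n, τ.R₀ (χ k) (-χ (k + 1))) →
        ∀ k ≤ n, ∃ f : CBS.Fn CBS.Coord, CBS.IsLocalSymmetry f ∧ χ k = CBS.pullback f) :=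
  ⟨CBS.exists_normalized_hierarchy, CBS.exists_next_local,
    fun _ => CBS.Covering.exists_local⟩
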